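/- A simple graph is \emph{outerplanar} if it can be drawn in the plane without crossings (vertices as distinct points, edges as simple arcs between their endpoints that pass through no other vertex and meet each other only in common endpoints) so that every vertex lies on the boundary of the outer (unbounded) face. For a simple graph $G$ on $n\ge 2$ vertices, the \emph{Fiedler value} $\lambda_2(G)$ is the second smallest eigenvalue, counted with multiplicity, of the Laplacian matrix $L(G)$. There is an absolute constant $C$ such that for every $n\ge 2$, every outerplanar graph $G$ on $n$ vertices satisfies $$\lambda_2(G)\le 1+\frac{C}{n}.$$ In other words, the maximum $\lambda_{2\max}$ of the Fiedler value over all outerplanar graphs on $n$ vertices satisfies $\lambda_{2\max}\le 1+O\!\left(\frac1n\right)$. -/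

import Mathlib

namespace FiedlerOuterplanar

/-- The Euclidean plane. -/
abbrev Plane : Type := EuclideanSpace ℝ (Fin 2)

/-- A plane drawing (planar embedding) of a simple graph: vertices are distinct points, every edge
is a simple arc between its two endpoints that passes through no other vertex, and two different
edges meet at most in common endpoints. The value of `arc` is used only on edges of the graph. -/
structure PlaneDrawing {V : Type*} (G : SimpleGraph V) where
  /-- The position of each vertex. -/
  point : V → Plane
  /-- The set of points of the curve that represents each edge. -/
  arc : Sym2 V → Set Plane
  point_injective : Function.Injective point
  exists_path : ∀ u v : V, G.Adj u v →
    ∃ γ : Path (point u) (point v), Function.Injective γ ∧ Set.range γ = arc s(u, v)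
  mem_of_point_mem_arc : ∀ e ∈ G.edgeSet, ∀ w : V, point w ∈ arc e → w ∈ e
  arc_inter_arc : ∀ e ∈ G.edgeSet, ∀ e' ∈ G.edgeSet, e ≠ e' →
    ∀ p ∈ arc e ∩ arc e', ∃ w : V, w ∈ e ∧ w ∈ e' ∧ p = point w

namespace PlaneDrawing

variable {V : Type*} {G : SimpleGraph V}

/-- The set of all points of the plane covered by the drawing. -/
def support (D : PlaneDrawing G) : Set Plane :=
  Set.range D.point ∪ ⋃ e ∈ G.edgeSet, D.arc e

/-- The outer face. The faces of a drawing are the connected components of the complement of the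
drawing; the outer face of a drawing of a finite graph is the unbounded one. It is given here as
the set of the points off the drawing whose face is unbounded. -/
def outerFace (D : PlaneDrawing G) : Set Plane :=
  {x | x ∉ D.support ∧ ¬ Bornology.IsBounded (connectedComponentIn D.supportᶜ x)}

end PlaneDrawing

/-- A graph is outerplanar if it has a plane drawing in which every vertex lies on the boundary of
the outer face. -/
def IsOuterplanar {V : Type*} (G : SimpleGraph V) : Prop :=
  ∃ D : PlaneDrawing G, ∀ v : V, D.point v ∈ frontier D.outerFace

open Classical in
/-- The Fiedler value: the second smallest eigenvalue, counted with multiplicity, of the Laplacian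
matrix of a graph with at least two vertices. (`Matrix.IsHermitian.eigenvalues₀` lists the
eigenvalues with multiplicity in decreasing order, with indices from `0` to `n - 1`.) -/
noncomputable def fiedlerValue {V : Type*} [Fintype V] (G : SimpleGraph V)
    (h : 2 ≤ Fintype.card V) : ℝ :=
  (G.isHermitian_lapMatrix ℝ).eigenvalues₀ ⟨Fintype.card V - 2, by omega⟩

end FiedlerOuterplanar

/-! If the Fiedler value exceeds 1, the graph is so well connected that its structure is forced, and
that structure provides a good test vector.

Topology. In an outerplanar drawing the outer face is a connected set whose closure contains every
vertex. Three internally disjoint paths between two vertices, each with an internal vertex, form a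
theta curve, and no connected set in its complement can be adherent to interior points of all three
arms (`false_of_theta`). Hence outerplanar graphs are theta-free (`IsOuterplanar.thetaFree`), and
nothing else about drawings is used.

Spectrum. Let a separator split the other vertices into `A` and `B`, with no edge between them. The
vector equal to `|B|` on `A`, `-|A|` on `B` and 0 on the separator has mean zero, and its Laplacian
form counts `x i ^ 2` once for each neighbour of `i` in the separator. If all but a few vertices
have at most one such neighbour, the Rayleigh quotient is at most 1 plus a small error
(`fiedlerValue_le_of_separation`). A cut vertex gives the bound 1 with no error.

Combinatorics. It remains to treat theta-free graphs without cut vertices. These are Hamiltonian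
(`exists_hamiltonian_isCycleList`), and the chords of the Hamiltonian cycle do not cross. As with a
polygon triangulation, some two vertices `u`, `v` separate two parts of linear size
(`exists_balanced_split`). Only common neighbours of `u` and `v` see the separator twice, and
theta-freeness allows at most two of them, so the error is `O(1/n)`. -/

namespace FiedlerOuterplanar

/-! ### Theta curves in the complex plane, by continuous logarithms -/

/-- Two continuous logarithms of the same function on a preconnected set that agree at one point
agree everywhere. -/
theorem eqOn_of_exp_eqOn {X : Type*} [TopologicalSpace X] {s : Set X} (hs : IsPreconnected s)
    {f g : X → ℂ} (hf : ContinuousOn f s) (hg : ContinuousOn g s)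
    (h : ∀ x ∈ s, Complex.exp (f x) = Complex.exp (g x)) {x : X} (hx : x ∈ s) (hfg : f x = g x) :
    Set.EqOn f g s :=
  Complex.isCoveringMap_exp.eqOn_of_comp_eqOn hs hf hg
    (fun y hy => Subtype.ext (h y hy)) hx hfg

/-- `L` is a continuous logarithm of `z ↦ (b - z) / (a - z)` off the set `K`. -/
structure IsLogOff (a b : ℂ) (K : Set ℂ) (L : ℂ → ℂ) : Prop where
  continuousOn : ContinuousOn L Kᶜ
  exp_eq : ∀ z ∉ K, Complex.exp (L z) = (b - z) / (a - z)

/-- Off a path from `a` to `b` the function `z ↦ (b - z) / (a - z)` has a continuous logarithm. -/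
theorem exists_isLogOff_range {a b : ℂ} (γ : Path a b) :
    ∃ L, IsLogOff a b (Set.range γ) L := by
  have hne : ∀ (t : unitInterval) (z : {z : ℂ // z ∉ Set.range γ}), γ t - z.1 ≠ 0 := fun t z h =>
    z.2 ⟨t, sub_eq_zero.1 h⟩
  -- Moving the numerator along `γ` deforms the constant 1, with logarithm 0, into the given
  -- quotient; the deformation lifts through the covering `exp`.
  let H : C(unitInterval × {z : ℂ // z ∉ Set.range γ}, {z : ℂ // z ≠ 0}) :=
    ⟨fun q => ⟨(γ q.1 - q.2.1) / (γ 0 - q.2.1), div_ne_zero (hne _ _) (hne _ _)⟩, by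
      refine Continuous.subtype_mk (Continuous.div (by fun_prop) (by fun_prop) ?_) _
      exact fun q => hne _ _⟩
  let f : C({z : ℂ // z ∉ Set.range γ}, ℂ) := ContinuousMap.const _ 0
  have H0 : ∀ z : {z : ℂ // z ∉ Set.range γ}, H (0, z) = (fun z : ℂ ↦ (⟨_, z.exp_ne_zero⟩ : {z : ℂ // z ≠ 0})) (f z) := by
    intro z
    refine Subtype.ext ?_
    simpa [H, f] using div_self (hne 0 z)
  let Λ := Complex.isCoveringMap_exp.liftHomotopy H f H0
  have hΛ : ∀ z : {z : ℂ // z ∉ Set.range γ}, Complex.exp (Λ (1, z)) = (b - z.1) / (a - z.1) := by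
    intro z
    have := congrArg Subtype.val
      (congrFun (Complex.isCoveringMap_exp.liftHomotopy_lifts H f H0) (1, z))
    exact this.trans (by simp [H])
  classical
  refine ⟨fun z => if h : z ∉ Set.range γ then Λ (1, ⟨z, h⟩) else 0, ?_, ?_⟩
  · rw [continuousOn_iff_continuous_domRestrict]
    have : Continuous fun z : {z : ℂ // z ∉ Set.range γ} => Λ (1, z) := by fun_prop
    refine this.congr fun z => ?_
    have := z.2
    simp only [Set.domRestrict_apply]
    rw [dif_pos this]
  · intro z hz
    simp only [hz, not_false_eq_true, dite_true]
    exact hΛ ⟨z, hz⟩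

/-- There is no continuous logarithm of `z ↦ (b - z) / (a - z)` on the plane without `a` and
`b`. -/
theorem not_isLogOff_pair {a b : ℂ} (hab : a ≠ b) (F : ℂ → ℂ) : ¬ IsLogOff a b {a, b} F := by
  intro hF
  have hba : b - a ≠ 0 := sub_ne_zero.2 hab.symm
  have hpos : 0 < ‖b - a‖ := norm_pos_iff.2 hba
  set r : ℝ := ‖b - a‖ / 2 with hr
  have hr0 : 0 < r := by positivity
  set c : ℝ → ℂ := circleMap a r with hc
  have hca : ∀ θ, c θ - a = r * Complex.exp (θ * Complex.I) := fun θ => by simp [hc, circleMap]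
  have hcn : ∀ θ, ‖c θ - a‖ = r := fun θ => by
    rw [hca, norm_mul, Complex.norm_exp_ofReal_mul_I]; simp [abs_of_pos hr0]
  have hc1 : ∀ θ, c θ ≠ a := fun θ h => by
    have := hcn θ
    rw [h] at this
    simp at this
    linarith
  have hc2 : ∀ θ, c θ ≠ b := fun θ h => by
    have := hcn θ
    rw [h] at this
    linarith
  have hcc : Continuous c := continuous_circleMap a r
  have hslit : ∀ θ, (b - c θ) / (b - a) ∈ Complex.slitPlane := by
    intro θ
    have : (b - c θ) / (b - a) = 1 + -((c θ - a) / (b - a)) := by field_simp; ring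
    rw [this]
    refine Complex.mem_slitPlane_of_norm_lt_one ?_
    rw [norm_neg, norm_div, hcn, hr]
    rw [div_lt_one hpos]; linarith
  -- On a circle around `a` that leaves `b` outside, `b - z` has the principal logarithm, so `F`
  -- would yield a continuous logarithm of `a - z`. `G` measures its difference from the angle: `exp
  -- ∘ G` is constant, hence so is `G`, yet the term `θ * I` changes by `2πi` in one turn.
  let G : ℝ → ℂ := fun θ => Complex.log ((b - c θ) / (b - a)) - F (c θ) - θ * Complex.I
  have hGc : Continuous G := by
    refine (Continuous.sub ?_ ?_).sub (by fun_prop)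
    · exact Continuous.clog (by fun_prop) hslit
    · exact hF.continuousOn.comp_continuous hcc fun θ => by simp [hc1, hc2]
  have hGe : ∀ θ, Complex.exp (G θ) = -r / (b - a) := by
    intro θ
    have h1 : b - c θ ≠ 0 := sub_ne_zero.2 (hc2 θ).symm
    have h2 : a - c θ ≠ 0 := sub_ne_zero.2 (hc1 θ).symm
    have h3 : a - c θ = -(r * Complex.exp (θ * Complex.I)) := by rw [← hca]; ring
    have h4 := Complex.exp_ne_zero (θ * Complex.I)
    simp only [G]
    rw [Complex.exp_sub, Complex.exp_sub, Complex.exp_log (div_ne_zero h1 hba),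
      hF.exp_eq _ (by simp [hc1, hc2])]
    rw [div_div_eq_mul_div, div_mul_eq_mul_div, div_div, div_div, h3]
    field_simp
  have hconst : G (2 * Real.pi) = G 0 :=
    eqOn_of_exp_eqOn (g := fun _ => G 0) isPreconnected_univ hGc.continuousOn
      continuousOn_const (fun θ _ => by rw [hGe, hGe]) (Set.mem_univ 0) rfl (Set.mem_univ _)
  have hper : c (2 * Real.pi) = c 0 := by simp [hc, circleMap]
  simp only [G, hper] at hconst
  simp [Real.pi_ne_zero] at hconst

/-- The median of three numbers. -/
def median (x y z : ℝ) : ℝ := max (min x y) (min (max x y) z)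

theorem median_self_left (x z : ℝ) : median x x z = x := by
  simp [median]

theorem median_self_outer (x y : ℝ) : median x y x = x := by
  rcases le_total x y with h | h <;> simp [median, h]

theorem median_self_right (x y : ℝ) : median x y y = y := by
  rcases le_total x y with h | h <;> simp [median, h]

theorem median_mem (x y z : ℝ) : median x y z = x ∨ median x y z = y ∨ median x y z = z := by
  unfold median
  rcases max_choice (min x y) (min (max x y) z) with h | h <;> rw [h]
  · rcases min_choice x y with h | h <;> simp [h]
  · rcases min_choice (max x y) z with h | h <;> rw [h]
    · rcases max_choice x y with h | h <;> simp [h]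
    · simp

/-- A small ball around `z` avoids both closed sets and is connected, so agreement at its centre
spreads over it. -/
theorem IsLogOff.eventuallyEq {a b : ℂ} {K K' : Set ℂ} {L L' : ℂ → ℂ} (hL : IsLogOff a b K L)
    (hL' : IsLogOff a b K' L') (hK : IsClosed K) (hK' : IsClosed K') {z : ℂ} (hz : z ∉ K)
    (hz' : z ∉ K') (h : L z = L' z) : L =ᶠ[nhds z] L' := by
  have hopen : IsOpen (Kᶜ ∩ K'ᶜ) := hK.isOpen_compl.inter hK'.isOpen_compl
  obtain ⟨ε, hε, hsub⟩ := Metric.isOpen_iff.1 hopen z ⟨hz, hz'⟩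
  filter_upwards [Metric.ball_mem_nhds z hε] with w hw
  refine eqOn_of_exp_eqOn (Metric.isPreconnected_ball (x := z) (r := ε))
    (hL.continuousOn.mono fun y hy => (hsub hy).1) (hL'.continuousOn.mono fun y hy => (hsub hy).2)
    (fun y hy => ?_) (Metric.mem_ball_self hε) h hw
  rw [hL.exp_eq _ (hsub hy).1, hL'.exp_eq _ (hsub hy).2]

theorem IsLogOff.re_eq {a b : ℂ} {K : Set ℂ} {L : ℂ → ℂ} (hL : IsLogOff a b K L) {z : ℂ}
    (hz : z ∉ K) : (L z).re = Real.log ‖(b - z) / (a - z)‖ := by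
  rw [← hL.exp_eq z hz, Complex.norm_exp, Real.log_exp]

theorem IsLogOff.continuousAt {a b : ℂ} {K : Set ℂ} {L : ℂ → ℂ} (hL : IsLogOff a b K L)
    (hK : IsClosed K) {z : ℂ} (hz : z ∉ K) : ContinuousAt L z :=
  hL.continuousOn.continuousAt (hK.isOpen_compl.mem_nhds hz)

/-- Three logarithms, any two of which agree on the set where the third one is undefined, would
have a median that is a global logarithm. -/
theorem false_of_isLogOff_agree {a b : ℂ} (hab : a ≠ b) {K₁ K₂ K₃ : Set ℂ} {L₁ L₂ L₃ : ℂ → ℂ}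
    (hK₁ : IsClosed K₁) (hK₂ : IsClosed K₂) (hK₃ : IsClosed K₃)
    (h₁₂ : K₁ ∩ K₂ ⊆ {a, b}) (h₁₃ : K₁ ∩ K₃ ⊆ {a, b}) (h₂₃ : K₂ ∩ K₃ ⊆ {a, b})
    (hL₁ : IsLogOff a b K₁ L₁) (hL₂ : IsLogOff a b K₂ L₂) (hL₃ : IsLogOff a b K₃ L₃)
    (e₁ : ∀ z ∈ K₁ \ {a, b}, L₂ z = L₃ z) (e₂ : ∀ z ∈ K₂ \ {a, b}, L₁ z = L₃ z)
    (e₃ : ∀ z ∈ K₃ \ {a, b}, L₁ z = L₂ z) : False := by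
  -- The real part of a logarithm is determined; only the imaginary part has to be glued. Near a
  -- point of `K₁` the function `L₁` may jump, but there `L₂` and `L₃` coincide and the median
  -- ignores `L₁`; likewise for `K₂` and `K₃`. Off all three sets the median is continuous and
  -- selects one of the three values.
  let μ : ℂ → ℝ := fun z => median (L₁ z).im (L₂ z).im (L₃ z).im
  let F : ℂ → ℂ := fun z =>
    (Real.log ‖(b - z) / (a - z)‖ : ℂ) + (μ z : ℂ) * Complex.I
  have hval : ∀ {K L z}, IsLogOff a b K L → z ∉ K → μ z = (L z).im →
      Complex.exp (F z) = (b - z) / (a - z) := by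
    intro K L z hL hz h
    have : F z = L z := by
      simp only [F]
      rw [← hL.re_eq hz, h, Complex.re_add_im]
    rw [this, hL.exp_eq z hz]
  refine not_isLogOff_pair hab F ⟨fun z hz => ?_, fun z hz => ?_⟩
  · have hza : a - z ≠ 0 := fun h => hz (by simp [sub_eq_zero.1 h])
    have hzb : b - z ≠ 0 := fun h => hz (by simp [sub_eq_zero.1 h])
    refine ContinuousAt.continuousWithinAt ?_
    have hre : ContinuousAt (fun z : ℂ => Real.log ‖(b - z) / (a - z)‖) z := by
      refine ContinuousAt.log (ContinuousAt.norm (ContinuousAt.div (by fun_prop) (by fun_prop) hza))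
        ?_
      exact norm_ne_zero_iff.2 (div_ne_zero hzb hza)
    have him : ContinuousAt μ z := by
      have him' : ∀ {L}, ContinuousAt L z → ContinuousAt (fun w => (L w : ℂ).im) z :=
        fun h => Complex.continuous_im.continuousAt.comp h
      by_cases z₁ : z ∈ K₁
      · have n₂ : z ∉ K₂ := fun h => hz (h₁₂ ⟨z₁, h⟩)
        have n₃ : z ∉ K₃ := fun h => hz (h₁₃ ⟨z₁, h⟩)
        refine (him' (hL₂.continuousAt hK₂ n₂)).congr ?_
        filter_upwards [hL₂.eventuallyEq hL₃ hK₂ hK₃ n₂ n₃ (e₁ z ⟨z₁, hz⟩)] with w hw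
        simp only [μ, hw, median_self_right]
      by_cases z₂ : z ∈ K₂
      · have n₃ : z ∉ K₃ := fun h => hz (h₂₃ ⟨z₂, h⟩)
        refine (him' (hL₁.continuousAt hK₁ z₁)).congr ?_
        filter_upwards [hL₁.eventuallyEq hL₃ hK₁ hK₃ z₁ n₃ (e₂ z ⟨z₂, hz⟩)] with w hw
        simp only [μ, hw, median_self_outer]
      by_cases z₃ : z ∈ K₃
      · refine (him' (hL₁.continuousAt hK₁ z₁)).congr ?_
        filter_upwards [hL₁.eventuallyEq hL₂ hK₁ hK₂ z₁ z₂ (e₃ z ⟨z₃, hz⟩)] with w hw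
        simp only [μ, hw, median_self_left]
      · have c₁ := him' (hL₁.continuousAt hK₁ z₁)
        have c₂ := him' (hL₂.continuousAt hK₂ z₂)
        have c₃ := him' (hL₃.continuousAt hK₃ z₃)
        exact (c₁.min c₂).max ((c₁.max c₂).min c₃)
    exact (Complex.continuous_ofReal.continuousAt.comp hre).add
      ((Complex.continuous_ofReal.continuousAt.comp him).mul continuousAt_const)
  · by_cases z₁ : z ∈ K₁
    · have n₂ : z ∉ K₂ := fun h => hz (h₁₂ ⟨z₁, h⟩)
      exact hval hL₂ n₂ (by simp only [μ, e₁ z ⟨z₁, hz⟩, median_self_right])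
    by_cases z₂ : z ∈ K₂
    · exact hval hL₁ z₁ (by simp only [μ, e₂ z ⟨z₂, hz⟩, median_self_outer])
    by_cases z₃ : z ∈ K₃
    · exact hval hL₁ z₁ (by simp only [μ, e₃ z ⟨z₃, hz⟩, median_self_left])
    rcases median_mem (L₁ z).im (L₂ z).im (L₃ z).im with h | h | h
    · exact hval hL₁ z₁ h
    · exact hval hL₂ z₂ h
    · exact hval hL₃ z₃ h

/-- A logarithm can be shifted to take a prescribed admissible value at a point. -/
theorem IsLogOff.exists_shift {a b : ℂ} {K : Set ℂ} {L : ℂ → ℂ} (hL : IsLogOff a b K L) {p w : ℂ}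
    (hp : p ∉ K) (hw : Complex.exp w = (b - p) / (a - p)) :
    ∃ L', IsLogOff a b K L' ∧ L' p = w := by
  refine ⟨fun z => L z + (w - L p), ⟨hL.continuousOn.add continuousOn_const, fun z hz => ?_⟩,
    by ring⟩
  have hne : Complex.exp w ≠ 0 := Complex.exp_ne_zero w
  rw [Complex.exp_add, Complex.exp_sub, hL.exp_eq p hp, hL.exp_eq z hz, hw]
  rw [hw] at hne
  rw [div_self hne, mul_one]

/-- Adding the adherent point `m` to `U` keeps it connected and links it to `S`; uniqueness of
logarithms then carries the agreement at `p` over to `S`. Here `S` is to be the open arm of one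
path, and `K`, `K'` the other two paths. -/
theorem IsLogOff.eqOn_of_mem_closure {a b : ℂ} {K K' U S : Set ℂ} {L L' : ℂ → ℂ}
    (hL : IsLogOff a b K L) (hL' : IsLogOff a b K' L') (hU : IsPreconnected U)
    (hS : IsPreconnected S) (hUK : Disjoint U K) (hUK' : Disjoint U K') (hSK : Disjoint S K)
    (hSK' : Disjoint S K') {m p : ℂ} (hm : m ∈ closure U) (hmS : m ∈ S) (hp : p ∈ U)
    (h : L p = L' p) : ∀ z ∈ S, L z = L' z := by
  have hpre : IsPreconnected (insert m U ∪ S) :=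
    IsPreconnected.union m (by simp) hmS
      (hU.subset_closure (Set.subset_insert m U) (Set.insert_subset hm subset_closure)) hS
  have hsub : ∀ {J}, Disjoint U J → Disjoint S J → insert m U ∪ S ⊆ Jᶜ := by
    rintro J h₁ h₂ z ((rfl | hz) | hz) hJ
    · exact Set.disjoint_left.1 h₂ hmS hJ
    · exact Set.disjoint_left.1 h₁ hz hJ
    · exact Set.disjoint_left.1 h₂ hz hJ
  intro z hz
  refine eqOn_of_exp_eqOn hpre (hL.continuousOn.mono (hsub hUK hSK))
    (hL'.continuousOn.mono (hsub hUK' hSK')) (fun y hy => ?_) (x := p) (by simp [hp]) h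
    (Or.inr hz)
  rw [hL.exp_eq _ (hsub hUK hSK hy), hL'.exp_eq _ (hsub hUK' hSK' hy)]

/-- If three paths from `a` to `b` meet only in `a` and `b`, then no connected set off the paths
has points of all three of them in its closure. -/
theorem false_of_theta_complex {a b : ℂ} (hab : a ≠ b) (γ₁ γ₂ γ₃ : Path a b)
    (h₁₂ : Set.range γ₁ ∩ Set.range γ₂ ⊆ {a, b}) (h₁₃ : Set.range γ₁ ∩ Set.range γ₃ ⊆ {a, b})
    (h₂₃ : Set.range γ₂ ∩ Set.range γ₃ ⊆ {a, b})
    (c₁ : IsPreconnected (Set.range γ₁ \ {a, b})) (c₂ : IsPreconnected (Set.range γ₂ \ {a, b}))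
    (c₃ : IsPreconnected (Set.range γ₃ \ {a, b})) {U : Set ℂ} (hU : IsPreconnected U)
    (d₁ : Disjoint U (Set.range γ₁)) (d₂ : Disjoint U (Set.range γ₂))
    (d₃ : Disjoint U (Set.range γ₃)) (m₁ : (closure U ∩ (Set.range γ₁ \ {a, b})).Nonempty)
    (m₂ : (closure U ∩ (Set.range γ₂ \ {a, b})).Nonempty)
    (m₃ : (closure U ∩ (Set.range γ₃ \ {a, b})).Nonempty) : False := by
  have hcl : ∀ γ : Path a b, IsClosed (Set.range γ) := fun γ =>
    (isCompact_range γ.continuous).isClosed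
  have hdis : ∀ {γ γ' : Path a b}, Set.range γ ∩ Set.range γ' ⊆ {a, b} →
      Disjoint (Set.range γ \ {a, b}) (Set.range γ') := fun h =>
    Set.disjoint_left.2 fun z hz hz' => hz.2 (h ⟨hz.1, hz'⟩)
  obtain ⟨q₁, hq₁, hq₁'⟩ := m₁
  obtain ⟨q₂, hq₂, hq₂'⟩ := m₂
  obtain ⟨q₃, hq₃, hq₃'⟩ := m₃
  obtain ⟨p, hp⟩ : U.Nonempty := closure_nonempty_iff.1 ⟨q₁, hq₁⟩
  obtain ⟨L₁, hL₁⟩ := exists_isLogOff_range γ₁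
  have hp₁ := hL₁.exp_eq p (Set.disjoint_left.1 d₁ hp)
  obtain ⟨L₂', hL₂'⟩ := exists_isLogOff_range γ₂
  obtain ⟨L₃', hL₃'⟩ := exists_isLogOff_range γ₃
  obtain ⟨L₂, hL₂, hp₂⟩ := hL₂'.exists_shift (Set.disjoint_left.1 d₂ hp) hp₁
  obtain ⟨L₃, hL₃, hp₃⟩ := hL₃'.exists_shift (Set.disjoint_left.1 d₃ hp) hp₁
  have h₂₁ := h₁₂; rw [Set.inter_comm] at h₂₁
  have h₃₁ := h₁₃; rw [Set.inter_comm] at h₃₁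
  have h₃₂ := h₂₃; rw [Set.inter_comm] at h₃₂
  exact false_of_isLogOff_agree hab (hcl γ₁) (hcl γ₂) (hcl γ₃) h₁₂ h₁₃ h₂₃ hL₁ hL₂ hL₃
    (hL₂.eqOn_of_mem_closure hL₃ hU c₁ d₂ d₃ (hdis h₁₂) (hdis h₁₃) hq₁ hq₁' hp (hp₂.trans hp₃.symm))
    (hL₁.eqOn_of_mem_closure hL₃ hU c₂ d₁ d₃ (hdis h₂₁) (hdis h₂₃) hq₂ hq₂' hp hp₃.symm)
    (hL₁.eqOn_of_mem_closure hL₂ hU c₃ d₁ d₂ (hdis h₃₁) (hdis h₃₂) hq₃ hq₃' hp hp₂.symm)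

/-- The points of norm greater than `r` form a connected set. -/
theorem isPreconnected_norm_gt_complex {r : ℝ} (hr : 0 < r) : IsPreconnected {z : ℂ | r < ‖z‖} := by
  -- The exterior of a disc is the exponential of a half-plane, which is convex.
  have himg : {z : ℂ | r < ‖z‖} = Complex.exp '' {w | Real.log r < w.re} := by
    ext z
    constructor
    · intro hz
      have hz' : r < ‖z‖ := hz
      have hz0 : z ≠ 0 := norm_pos_iff.1 (hr.trans hz')
      refine ⟨Complex.log z, ?_, Complex.exp_log hz0⟩
      simpa [Complex.log_re] using Real.log_lt_log hr hz'
    · rintro ⟨w, hw, rfl⟩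
      have hw' : Real.log r < w.re := hw
      simpa [Complex.norm_exp] using (Real.log_lt_iff_lt_exp hr).1 hw'
  rw [himg]
  exact (convex_halfSpace_re_gt _).isPreconnected.image _ Complex.continuous_exp.continuousOn

end FiedlerOuterplanar

/-! ### Plane drawings: outerplanar graphs are theta-free -/

namespace FiedlerOuterplanar

/-- An identification of the Euclidean plane with the complex numbers. -/
noncomputable def planeEquiv : Plane ≃ₗᵢ[ℝ] ℂ := Complex.orthonormalBasisOneI.repr.symm

theorem isPreconnected_norm_gt {r : ℝ} (hr : 0 < r) : IsPreconnected {z : Plane | r < ‖z‖} := by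
  have h : {z : Plane | r < ‖z‖} = planeEquiv.symm '' {z : ℂ | r < ‖z‖} := by
    ext z
    constructor
    · intro hz
      refine ⟨planeEquiv z, ?_, by simp⟩
      simpa using hz
    · rintro ⟨w, hw, rfl⟩
      simpa using hw
  rw [h]
  exact (isPreconnected_norm_gt_complex hr).image _ planeEquiv.symm.continuous.continuousOn

theorem false_of_theta {a b : Plane} (hab : a ≠ b) (γ₁ γ₂ γ₃ : Path a b)
    (h₁₂ : Set.range γ₁ ∩ Set.range γ₂ ⊆ {a, b}) (h₁₃ : Set.range γ₁ ∩ Set.range γ₃ ⊆ {a, b})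
    (h₂₃ : Set.range γ₂ ∩ Set.range γ₃ ⊆ {a, b})
    (c₁ : IsPreconnected (Set.range γ₁ \ {a, b})) (c₂ : IsPreconnected (Set.range γ₂ \ {a, b}))
    (c₃ : IsPreconnected (Set.range γ₃ \ {a, b})) {U : Set Plane} (hU : IsPreconnected U)
    (d₁ : Disjoint U (Set.range γ₁)) (d₂ : Disjoint U (Set.range γ₂))
    (d₃ : Disjoint U (Set.range γ₃)) (m₁ : (closure U ∩ (Set.range γ₁ \ {a, b})).Nonempty)
    (m₂ : (closure U ∩ (Set.range γ₂ \ {a, b})).Nonempty)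
    (m₃ : (closure U ∩ (Set.range γ₃ \ {a, b})).Nonempty) : False := by
  let e : Plane ≃ₜ ℂ := planeEquiv.toHomeomorph
  have hr : ∀ γ : Path a b, Set.range (γ.map e.continuous) = e '' Set.range γ := fun γ => by
    rw [← Set.range_comp]; rfl
  have hp : ({e a, e b} : Set ℂ) = e '' {a, b} := (Set.image_pair _ _ _).symm
  have hd : ∀ γ : Path a b, Set.range (γ.map e.continuous) \ {e a, e b} =
      e '' (Set.range γ \ {a, b}) := fun γ => by
    rw [hr, hp, Set.image_sdiff e.injective]
  have hi : ∀ {γ γ' : Path a b}, Set.range γ ∩ Set.range γ' ⊆ {a, b} →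
      Set.range (γ.map e.continuous) ∩ Set.range (γ'.map e.continuous) ⊆ {e a, e b} := by
    intro γ γ' h
    rw [hr, hr, hp, ← Set.image_inter e.injective]
    exact Set.image_mono h
  have hc : ∀ {γ : Path a b}, IsPreconnected (Set.range γ \ {a, b}) →
      IsPreconnected (Set.range (γ.map e.continuous) \ {e a, e b}) := fun h => by
    rw [hd]; exact h.image _ e.continuous.continuousOn
  have hdis : ∀ {γ : Path a b}, Disjoint U (Set.range γ) →
      Disjoint (e '' U) (Set.range (γ.map e.continuous)) := fun h => by
    rw [hr]; exact (Set.disjoint_image_iff e.injective).2 h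
  have hm : ∀ {γ : Path a b}, (closure U ∩ (Set.range γ \ {a, b})).Nonempty →
      (closure (e '' U) ∩ (Set.range (γ.map e.continuous) \ {e a, e b})).Nonempty := fun h => by
    rw [hd, ← e.image_closure, ← Set.image_inter e.injective]; exact h.image _
  exact false_of_theta_complex (e.injective.ne hab) (γ₁.map e.continuous) (γ₂.map e.continuous)
    (γ₃.map e.continuous) (hi h₁₂) (hi h₁₃) (hi h₂₃) (hc c₁) (hc c₂) (hc c₃)
    (hU.image _ e.continuous.continuousOn) (hdis d₁) (hdis d₂) (hdis d₃) (hm m₁) (hm m₂) (hm m₃)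

namespace PlaneDrawing

variable {V : Type*} {G : SimpleGraph V}

theorem isBounded_support [Finite V] (D : PlaneDrawing G) : Bornology.IsBounded D.support := by
  refine (Set.finite_range _).isBounded.union ?_
  refine (Bornology.isBounded_biUnion (Set.toFinite _)).2 fun e => ?_
  induction e with
  | _ u v =>
    intro h
    obtain ⟨γ, -, hγ⟩ := D.exists_path u v h
    rw [← hγ]
    exact (isCompact_range γ.continuous).isBounded

/-- The drawing lies in a disc, and the exterior of the disc is connected. Every unbounded component
reaches that exterior, so there is at most one. -/
theorem isPreconnected_outerFace [Finite V] (D : PlaneDrawing G) :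
    IsPreconnected D.outerFace := by
  obtain ⟨r, hr, hsub⟩ := D.isBounded_support.subset_closedBall_lt 0 0
  have hW : {z : Plane | r < ‖z‖} ⊆ D.supportᶜ := fun z hz h => by
    have := hsub h
    simp only [mem_closedBall_zero_iff] at this
    exact absurd hz (not_lt.2 this)
  have hfar : ∀ x ∈ D.outerFace, ∃ y, r < ‖y‖ ∧ y ∈ connectedComponentIn D.supportᶜ x := by
    rintro x ⟨-, hx⟩
    by_contra! hcon
    refine hx ((Metric.isBounded_closedBall (x := (0 : Plane)) (r := r)).subset fun y hy => ?_)
    by_contra h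
    rw [mem_closedBall_zero_iff, not_le] at h
    exact hcon y h hy
  rcases D.outerFace.eq_empty_or_nonempty with h | ⟨x, hx⟩
  · rw [h]; exact isPreconnected_empty
  suffices h : D.outerFace = connectedComponentIn D.supportᶜ x by
    rw [h]; exact isPreconnected_connectedComponentIn
  obtain ⟨w, hw, hwx⟩ := hfar x hx
  ext y
  constructor
  · intro hy
    obtain ⟨v, hv, hvy⟩ := hfar y hy
    have h₁ : v ∈ connectedComponentIn D.supportᶜ w :=
      (isPreconnected_norm_gt hr).subset_connectedComponentIn hw hW hv
    rw [connectedComponentIn_eq hwx, connectedComponentIn_eq h₁, ← connectedComponentIn_eq hvy]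
    exact mem_connectedComponentIn hy.1
  · intro hy
    refine ⟨connectedComponentIn_subset _ _ hy, ?_⟩
    rw [← connectedComponentIn_eq hy]
    exact hx.2

theorem arc_subset_support (D : PlaneDrawing G) {e : Sym2 V} (he : e ∈ G.edgeSet) :
    D.arc e ⊆ D.support := fun _ hz => Or.inr (Set.mem_biUnion he hz)

theorem point_left_mem_arc (D : PlaneDrawing G) {u v : V} (h : G.Adj u v) :
    D.point u ∈ D.arc s(u, v) := by
  obtain ⟨γ, -, hγ⟩ := D.exists_path u v h
  rw [← hγ]
  exact ⟨0, γ.source⟩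

theorem point_right_mem_arc (D : PlaneDrawing G) {u v : V} (h : G.Adj u v) :
    D.point v ∈ D.arc s(u, v) := by
  rw [Sym2.eq_swap]
  exact D.point_left_mem_arc h.symm

theorem isPreconnected_arc_diff_right (D : PlaneDrawing G) {u v : V} (h : G.Adj u v) :
    IsPreconnected (D.arc s(u, v) \ {D.point v}) := by
  obtain ⟨γ, hinj, hγ⟩ := D.exists_path u v h
  have : D.arc s(u, v) \ {D.point v} = γ '' Set.Iio 1 := by
    have h1 : ({D.point v} : Set Plane) = γ '' {1} := by simp
    rw [← hγ, h1, ← Set.image_univ, ← Set.image_sdiff hinj]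
    congr 1
    ext t
    simp [lt_iff_le_and_ne, unitInterval.le_one']
  rw [this]
  exact isPreconnected_Iio.image _ γ.continuous.continuousOn

theorem isPreconnected_arc_diff_left (D : PlaneDrawing G) {u v : V} (h : G.Adj u v) :
    IsPreconnected (D.arc s(u, v) \ {D.point u}) := by
  rw [Sym2.eq_swap]
  exact D.isPreconnected_arc_diff_right h.symm

/-- The curve that a drawing assigns to a walk, given by the list of its vertices. -/
theorem exists_path_of_isChain (D : PlaneDrawing G) {b : V} (q : List V) (x : V)
    (hb : b ∉ x :: q) (hq : (x :: q ++ [b]).IsChain G.Adj) :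
    ∃ γ : Path (D.point x) (D.point b), IsPreconnected (Set.range γ \ {D.point b}) ∧
      ∀ z ∈ Set.range γ, ∃ e ∈ G.edgeSet, z ∈ D.arc e ∧ (∃ w ∈ e, w ∈ x :: q) ∧
        ∀ w ∈ e, w ∈ x :: q ∨ w = b := by
  induction q generalizing x with
  | nil =>
    have hadj : G.Adj x b := by simpa using hq
    obtain ⟨γ, -, hγ⟩ := D.exists_path x b hadj
    refine ⟨γ, hγ ▸ D.isPreconnected_arc_diff_right hadj, fun z hz =>
      ⟨s(x, b), hadj, hγ ▸ hz, ⟨x, by simp, by simp⟩, by simp⟩⟩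
  | cons y q ih =>
    have hadj : G.Adj x y := by
      simp only [List.cons_append, List.isChain_cons_cons] at hq
      exact hq.1
    have hq' : (y :: q ++ [b]).IsChain G.Adj := by
      simp only [List.cons_append, List.isChain_cons_cons] at hq
      exact hq.2
    have hb' : b ∉ y :: q := fun h => hb (List.mem_cons_of_mem _ h)
    have hyb : y ≠ b := fun h => hb' (by simp [h])
    have hxb : x ≠ b := fun h => hb (by simp [h])
    obtain ⟨γ, hγc, hγe⟩ := ih y hb' hq'
    obtain ⟨δ, -, hδ⟩ := D.exists_path x y hadj
    refine ⟨δ.trans γ, ?_, ?_⟩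
    · have hnot : D.point b ∉ D.arc s(x, y) := fun h => by
        have := D.mem_of_point_mem_arc _ hadj b h
        rcases Sym2.mem_iff.1 this with rfl | rfl
        · exact hxb rfl
        · exact hyb rfl
      rw [Path.trans_range, Set.union_sdiff_distrib, hδ, Set.sdiff_singleton_eq_self hnot]
      refine IsPreconnected.union (D.point y) (D.point_right_mem_arc hadj)
        ⟨⟨0, γ.source⟩, fun h => hyb (D.point_injective h)⟩ ?_ hγc
      rw [← hδ]
      exact isPreconnected_range δ.continuous
    · rw [Path.trans_range]
      rintro z (hz | hz)
      · exact ⟨s(x, y), hadj, hδ ▸ hz, ⟨x, by simp, by simp⟩, by simp⟩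
      · obtain ⟨e, he, hze, ⟨w, hw, hw'⟩, hall⟩ := hγe z hz
        refine ⟨e, he, hze, ⟨w, hw, List.mem_cons_of_mem _ hw'⟩, fun w hw => ?_⟩
        exact (hall w hw).imp_left (List.mem_cons_of_mem _)

/-- The curve is recorded through the edges that cover it. That each of them has an end in `p` tells
the edges of disjoint walks apart, and the vertex of the last clause is a point of the open arm
adherent to the outer face. -/
theorem exists_path_through (D : PlaneDrawing G) {a b : V} {p : List V} (hp : p ≠ [])
    (hab : a ≠ b) (ha : a ∉ p) (hb : b ∉ p) (hch : (a :: p ++ [b]).IsChain G.Adj) :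
    ∃ γ : Path (D.point a) (D.point b),
      IsPreconnected (Set.range γ \ {D.point a, D.point b}) ∧
      (∀ z ∈ Set.range γ, ∃ e ∈ G.edgeSet, z ∈ D.arc e ∧ (∃ w ∈ e, w ∈ p) ∧
        ∀ w ∈ e, w ∈ p ∨ w = a ∨ w = b) ∧
      ∃ w, D.point w ∈ Set.range γ \ {D.point a, D.point b} := by
  obtain ⟨x, q, rfl⟩ := List.exists_cons_of_ne_nil hp
  have hadj : G.Adj a x := by
    simp only [List.cons_append, List.isChain_cons_cons] at hch
    exact hch.1
  have hch' : (x :: q ++ [b]).IsChain G.Adj := by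
    simp only [List.cons_append, List.isChain_cons_cons] at hch
    exact hch.2
  have hxa : x ≠ a := fun h => ha (by simp [h])
  have hxb : x ≠ b := fun h => hb (by simp [h])
  obtain ⟨γ, hγc, hγe⟩ := D.exists_path_of_isChain q x hb hch'
  obtain ⟨δ, -, hδ⟩ := D.exists_path a x hadj
  have hb' : D.point b ∉ Set.range δ := fun h => by
    rw [hδ] at h
    have := D.mem_of_point_mem_arc _ hadj b h
    rcases Sym2.mem_iff.1 this with rfl | rfl
    · exact hab rfl
    · exact hxb rfl
  have ha' : D.point a ∉ Set.range γ := fun h => by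
    obtain ⟨e, he, hze, -, hall⟩ := hγe _ h
    rcases hall a (D.mem_of_point_mem_arc e he a hze) with h | h
    · exact ha h
    · exact hab h
  have hmem : D.point x ∈ Set.range γ \ {D.point b} :=
    ⟨⟨0, γ.source⟩, fun h => hxb (D.point_injective h)⟩
  have heq : Set.range (δ.trans γ) \ {D.point a, D.point b} =
      (Set.range δ \ {D.point a}) ∪ (Set.range γ \ {D.point b}) := by
    rw [Path.trans_range]
    ext z
    simp only [Set.mem_sdiff, Set.mem_union, Set.mem_insert_iff, Set.mem_singleton_iff, not_or]
    constructor
    · rintro ⟨h | h, h₁, h₂⟩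
      · exact Or.inl ⟨h, h₁⟩
      · exact Or.inr ⟨h, h₂⟩
    · rintro (⟨h, h₁⟩ | ⟨h, h₁⟩)
      · exact ⟨Or.inl h, h₁, fun h' => hb' (h' ▸ h)⟩
      · exact ⟨Or.inr h, fun h' => ha' (h' ▸ h), h₁⟩
  refine ⟨δ.trans γ, ?_, ?_, x, ?_⟩
  · rw [heq]
    refine IsPreconnected.union (D.point x) ⟨⟨1, δ.target⟩, fun h => hxa (D.point_injective h)⟩
      hmem ?_ hγc
    rw [hδ]
    exact D.isPreconnected_arc_diff_left hadj
  · rw [Path.trans_range]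
    rintro z (hz | hz)
    · exact ⟨s(a, x), hadj, hδ ▸ hz, ⟨x, by simp, by simp⟩, by simp⟩
    · obtain ⟨e, he, hze, hw, hall⟩ := hγe z hz
      exact ⟨e, he, hze, hw, fun w hw => (hall w hw).imp_right Or.inr⟩
  · rw [heq]
    exact Or.inr hmem

end PlaneDrawing

/-- A graph is theta-free if no two vertices are joined by three internally disjoint walks each of
which has an internal vertex. The walks are given by the lists of their internal vertices. -/
def ThetaFree {V : Type*} (G : SimpleGraph V) : Prop :=
  ∀ (a b : V) (p₁ p₂ p₃ : List V), a ≠ b → p₁ ≠ [] → p₂ ≠ [] → p₃ ≠ [] →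
    a ∉ p₁ → a ∉ p₂ → a ∉ p₃ → b ∉ p₁ → b ∉ p₂ → b ∉ p₃ →
    p₁.Disjoint p₂ → p₁.Disjoint p₃ → p₂.Disjoint p₃ →
    (a :: p₁ ++ [b]).IsChain G.Adj → (a :: p₂ ++ [b]).IsChain G.Adj →
    (a :: p₃ ++ [b]).IsChain G.Adj → False

theorem IsOuterplanar.thetaFree {V : Type*} [Finite V] {G : SimpleGraph V}
    (hG : IsOuterplanar G) : ThetaFree G := by
  obtain ⟨D, hD⟩ := hG
  intro a b p₁ p₂ p₃ hab n₁ n₂ n₃ a₁ a₂ a₃ b₁ b₂ b₃ d₁₂ d₁₃ d₂₃ c₁ c₂ c₃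
  obtain ⟨γ₁, k₁, e₁, w₁, m₁⟩ := D.exists_path_through n₁ hab a₁ b₁ c₁
  obtain ⟨γ₂, k₂, e₂, w₂, m₂⟩ := D.exists_path_through n₂ hab a₂ b₂ c₂
  obtain ⟨γ₃, k₃, e₃, w₃, m₃⟩ := D.exists_path_through n₃ hab a₃ b₃ c₃
  have hinter : ∀ {p p' : List V} {S S' : Set Plane}, p.Disjoint p' → a ∉ p → b ∉ p →
      (∀ z ∈ S, ∃ e ∈ G.edgeSet, z ∈ D.arc e ∧ (∃ w ∈ e, w ∈ p) ∧
        ∀ w ∈ e, w ∈ p ∨ w = a ∨ w = b) →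
      (∀ z ∈ S', ∃ e ∈ G.edgeSet, z ∈ D.arc e ∧ (∃ w ∈ e, w ∈ p') ∧
        ∀ w ∈ e, w ∈ p' ∨ w = a ∨ w = b) → S ∩ S' ⊆ {D.point a, D.point b} := by
    rintro p p' S S' hdis hap hbp h h' z ⟨hz, hz'⟩
    obtain ⟨e, he, hze, ⟨w, hwe, hwp⟩, hall⟩ := h z hz
    obtain ⟨e', he', hze', -, hall'⟩ := h' z hz'
    -- An internal vertex of the first walk is an end of `e` but cannot be an end of `e'`. So the
    -- arcs belong to different edges and meet only in common ends, which must be `a` or `b`.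
    have hne : e ≠ e' := by
      rintro rfl
      rcases hall' w hwe with h | rfl | rfl
      · exact hdis hwp h
      · exact hap hwp
      · exact hbp hwp
    obtain ⟨v, hv, hv', rfl⟩ := D.arc_inter_arc e he e' he' hne z ⟨hze, hze'⟩
    rcases hall v hv with h | rfl | rfl
    · rcases hall' v hv' with h' | rfl | rfl
      · exact absurd h' (hdis h)
      · simp
      · simp
    · simp
    · simp
  have hout : ∀ {p : List V} {S : Set Plane}, (∀ z ∈ S, ∃ e ∈ G.edgeSet, z ∈ D.arc e ∧
      (∃ w ∈ e, w ∈ p) ∧ ∀ w ∈ e, w ∈ p ∨ w = a ∨ w = b) → Disjoint D.outerFace S := by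
    intro p S h
    refine Set.disjoint_right.2 fun z hz hz' => ?_
    obtain ⟨e, he, hze, -⟩ := h z hz
    exact hz'.1 (D.arc_subset_support he hze)
  have hcl : ∀ w, D.point w ∈ closure D.outerFace := fun w => frontier_subset_closure (hD w)
  exact false_of_theta (D.point_injective.ne hab) γ₁ γ₂ γ₃ (hinter d₁₂ a₁ b₁ e₁ e₂)
    (hinter d₁₃ a₁ b₁ e₁ e₃) (hinter d₂₃ a₂ b₂ e₂ e₃) k₁ k₂ k₃ D.isPreconnected_outerFace
    (hout e₁) (hout e₂) (hout e₃) ⟨_, hcl w₁, m₁⟩ ⟨_, hcl w₂, m₂⟩ ⟨_, hcl w₃, m₃⟩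

end FiedlerOuterplanar

/-! ### Upper bounds for the Fiedler value by test vectors -/

namespace FiedlerOuterplanar

/-- On the orthogonal complement of the last eigenvector, the quadratic form of a symmetric
operator is bounded below by the last but one eigenvalue. -/
theorem eigenvalue_mul_norm_sq_le {E : Type*} [NormedAddCommGroup E] [InnerProductSpace ℝ E]
    [FiniteDimensional ℝ E] {T : E →ₗ[ℝ] E} (hT : T.IsSymmetric) {n : ℕ}
    (hn : Module.finrank ℝ E = n) (h : 2 ≤ n) {y : E}
    (hy : inner ℝ (hT.eigenvectorBasis hn ⟨n - 1, by omega⟩) y = 0) :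
    hT.eigenvalues hn ⟨n - 2, by omega⟩ * ‖y‖ ^ 2 ≤ inner ℝ y (T y) := by
  set b := hT.eigenvectorBasis hn with hb
  rw [← b.sum_inner_mul_inner y (T y), ← b.sum_sq_norm_inner_right y, Finset.mul_sum]
  refine Finset.sum_le_sum fun i _ => ?_
  have h₁ : inner ℝ (b i) (T y) = hT.eigenvalues hn i * inner ℝ (b i) y := by
    rw [← hT, hb, hT.apply_eigenvectorBasis, inner_smul_left]
    simp
  rw [h₁, real_inner_comm (b i) y, Real.norm_eq_abs, sq_abs]
  rcases eq_or_ne i ⟨n - 1, by omega⟩ with rfl | hi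
  · simp [hy]
  · have hle : hT.eigenvalues hn ⟨n - 2, by omega⟩ ≤ hT.eigenvalues hn i := by
      refine hT.eigenvalues_antitone hn ?_
      have : (i : ℕ) ≠ n - 1 := fun h => hi (Fin.ext h)
      rw [Fin.le_def]
      have := i.2
      simp only
      omega
    nlinarith [sq_nonneg (inner ℝ (b i) y)]

variable {V : Type*} [Fintype V] {G : SimpleGraph V}

open Classical in
/-- The quadratic form of the Laplacian matrix. -/
noncomputable def lapForm (G : SimpleGraph V) (x : V → ℝ) : ℝ :=
  (∑ i, ∑ j, if G.Adj i j then (x i - x j) ^ 2 else 0) / 2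

theorem lapForm_nonneg (x : V → ℝ) : 0 ≤ lapForm G x := by
  classical
  refine div_nonneg (Finset.sum_nonneg fun i _ => Finset.sum_nonneg fun j _ => ?_) zero_le_two
  split_ifs <;> positivity

theorem lapForm_affine (x : V → ℝ) (α β : ℝ) :
    lapForm G (fun i => α + β * x i) = β ^ 2 * lapForm G x := by
  classical
  unfold lapForm
  rw [mul_div_assoc', Finset.mul_sum]
  congr 1
  refine Finset.sum_congr rfl fun i _ => ?_
  rw [Finset.mul_sum]
  refine Finset.sum_congr rfl fun j _ => ?_
  split_ifs <;> ring

open Classical in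
theorem inner_toEuclideanLin_lapMatrix (x : V → ℝ) :
    inner ℝ (WithLp.toLp 2 x) ((G.lapMatrix ℝ).toEuclideanLin (WithLp.toLp 2 x)) =
      lapForm G x := by
  have h := G.lapMatrix_toLinearMap₂' ℝ x
  rw [Matrix.toLinearMap₂'_apply'] at h
  unfold lapForm
  rw [← h, EuclideanSpace.inner_eq_star_dotProduct]
  simp [Matrix.toLpLin_apply, dotProduct_comm]

/-- The variational upper bound for the Fiedler value. -/
theorem fiedlerValue_le_of_lapForm_le (h : 2 ≤ Fintype.card V) {x : V → ℝ} (hx : ∑ i, x i = 0)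
    (hx₀ : 0 < ∑ i, x i ^ 2) {R : ℝ} (hR : lapForm G x ≤ R * ∑ i, x i ^ 2) :
    fiedlerValue G h ≤ R := by
  classical
  have hR₀ : 0 ≤ R := by
    by_contra hneg
    nlinarith [lapForm_nonneg (G := G) x, mul_pos (not_le.1 hneg |> neg_pos.2) hx₀]
  -- Adding a constant to a mean-zero vector leaves the form unchanged and only increases the norm,
  -- so every nonzero `α + β * x` still has Rayleigh quotient at most `R`. It suffices to find one
  -- orthogonal to the last eigenvector, which thus need not be identified with the constant vector.
  have key : ∀ α β : ℝ, 0 < ∑ i, (α + β * x i) ^ 2 →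
      inner ℝ ((Matrix.isSymmetric_toEuclideanLin_iff.mpr
        (G.isHermitian_lapMatrix ℝ)).eigenvectorBasis finrank_euclideanSpace
          ⟨Fintype.card V - 1, by omega⟩) (WithLp.toLp 2 fun i => α + β * x i) = 0 →
      fiedlerValue G h ≤ R := by
    intro α β hpos hin
    have h₁ := eigenvalue_mul_norm_sq_le (Matrix.isSymmetric_toEuclideanLin_iff.mpr
        (G.isHermitian_lapMatrix ℝ)) finrank_euclideanSpace h hin
    rw [inner_toEuclideanLin_lapMatrix, lapForm_affine, EuclideanSpace.norm_sq_eq] at h₁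
    simp only [Real.norm_eq_abs, sq_abs] at h₁
    have h₂ : ∑ i, (α + β * x i) ^ 2 = Fintype.card V * α ^ 2 + β ^ 2 * ∑ i, x i ^ 2 := by
      have : ∀ i, (α + β * x i) ^ 2 = α ^ 2 + 2 * α * β * x i + β ^ 2 * x i ^ 2 :=
        fun i => by ring
      simp only [this, Finset.sum_add_distrib, ← Finset.mul_sum, hx]
      simp
    have h₃ : β ^ 2 * lapForm G x ≤ R * ∑ i, (α + β * x i) ^ 2 := by
      rw [h₂]
      have : 0 ≤ R * (Fintype.card V * α ^ 2) := by positivity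
      nlinarith [mul_le_mul_of_nonneg_left hR (sq_nonneg β)]
    exact le_of_mul_le_mul_right (h₁.trans h₃) hpos
  set v := (Matrix.isSymmetric_toEuclideanLin_iff.mpr
        (G.isHermitian_lapMatrix ℝ)).eigenvectorBasis finrank_euclideanSpace
          ⟨Fintype.card V - 1, by omega⟩ with hv
  have hlin : ∀ α β : ℝ, inner ℝ v (WithLp.toLp 2 fun i => α + β * x i) =
      α * ∑ i, v i + β * ∑ i, v i * x i := by
    intro α β
    rw [PiLp.inner_apply, Finset.mul_sum, Finset.mul_sum, ← Finset.sum_add_distrib]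
    refine Finset.sum_congr rfl fun i _ => ?_
    simp
    ring
  by_cases hs : ∑ i, v i = 0
  · refine key 1 0 ?_ ?_
    · have : 0 < Fintype.card V := by omega
      simpa using this
    · rw [hlin, hs]; ring
  · refine key (-∑ i, v i * x i) (∑ i, v i) ?_ ?_
    · have : ∀ (α β : ℝ), ∑ i, (α + β * x i) ^ 2 =
          Fintype.card V * α ^ 2 + β ^ 2 * ∑ i, x i ^ 2 := by
        intro α β
        have : ∀ i, (α + β * x i) ^ 2 = α ^ 2 + 2 * α * β * x i + β ^ 2 * x i ^ 2 :=
          fun i => by ring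
        simp only [this, Finset.sum_add_distrib, ← Finset.mul_sum, hx]
        simp
      rw [this]
      positivity
    · rw [hlin]; ring

/-- A crude bound for the Fiedler value. -/
theorem fiedlerValue_le_two_mul_card (h : 2 ≤ Fintype.card V) :
    fiedlerValue G h ≤ 2 * Fintype.card V := by
  classical
  obtain ⟨u, v, huv⟩ := Fintype.one_lt_card_iff.1 h
  let x : V → ℝ := fun i => (if i = u then 1 else 0) - if i = v then 1 else 0
  refine fiedlerValue_le_of_lapForm_le h (x := x) (by simp [x]) ?_ ?_
  · refine Finset.sum_pos' (fun i _ => sq_nonneg _) ⟨u, Finset.mem_univ u, ?_⟩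
    simp [x, huv]
  · have : ∀ i j, (if G.Adj i j then (x i - x j) ^ 2 else 0) ≤ 2 * (x i ^ 2 + x j ^ 2) := by
      intro i j
      split_ifs
      · nlinarith [sq_nonneg (x i + x j)]
      · positivity
    unfold lapForm
    rw [div_le_iff₀ two_pos]
    refine (Finset.sum_le_sum fun i _ => Finset.sum_le_sum fun j _ => this i j).trans
      (le_of_eq ?_)
    simp only [← Finset.mul_sum, Finset.sum_add_distrib, Finset.sum_const, Finset.card_univ,
      nsmul_eq_mul]
    ring

open Classical in
/-- If the sets `A` and `B` are separated by a set in which all vertices, apart from the ones in a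
small set `T`, have at most one neighbour, then the Fiedler value is not much larger than one. -/
theorem fiedlerValue_le_of_separation (h : 2 ≤ Fintype.card V) (A B T : Finset V) {m : ℕ}
    (hm : 0 < m) (hA : m ≤ A.card) (hB : m ≤ B.card) (hAB : Disjoint A B)
    (hsep : ∀ a ∈ A, ∀ b ∈ B, ¬ G.Adj a b)
    (hdeg : ∀ w, ((Finset.univ.filter fun s => G.Adj w s ∧ s ∉ A ∧ s ∉ B).card : ℝ) ≤
      1 + if w ∈ T then 1 else 0) :
    fiedlerValue G h ≤ 1 + T.card / m := by
  set a : ℝ := (A.card : ℝ) with ha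
  set b : ℝ := (B.card : ℝ) with hb
  have ham : (m : ℝ) ≤ a := by rw [ha]; exact_mod_cast hA
  have hbm : (m : ℝ) ≤ b := by rw [hb]; exact_mod_cast hB
  have hm' : (0 : ℝ) < m := by exact_mod_cast hm
  have ha0 : 0 < a := hm'.trans_le ham
  have hb0 : 0 < b := hm'.trans_le hbm
  let x : V → ℝ := fun i => if i ∈ A then b else if i ∈ B then -a else 0
  have hxA : ∀ i ∈ A, x i = b := fun i hi => by simp [x, hi]
  have hxB : ∀ i ∈ B, x i = -a := fun i hi => by
    have : i ∉ A := fun h => Finset.disjoint_left.1 hAB h hi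
    simp [x, hi, this]
  have hx0 : ∀ i, i ∉ A → i ∉ B → x i = 0 := fun i h₁ h₂ => by simp [x, h₁, h₂]
  have hsum : ∀ f : V → ℝ, (∀ i, i ∉ A → i ∉ B → f i = 0) →
      ∑ i, f i = ∑ i ∈ A, f i + ∑ i ∈ B, f i := by
    intro f hf
    rw [← Finset.sum_union hAB]
    refine (Finset.sum_subset (Finset.subset_univ _) fun i _ hi => ?_).symm
    rw [Finset.mem_union, not_or] at hi
    exact hf i hi.1 hi.2
  have hx1 : ∑ i, x i = 0 := by
    rw [hsum x hx0, Finset.sum_congr rfl hxA, Finset.sum_congr rfl hxB]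
    simp only [Finset.sum_const, nsmul_eq_mul]
    ring
  have hx2 : ∑ i, x i ^ 2 = a * b * (a + b) := by
    rw [hsum (fun i => x i ^ 2) fun i h₁ h₂ => by simp [hx0 i h₁ h₂],
      Finset.sum_congr (s₁ := A) (g := fun _ => b ^ 2) rfl fun i hi => by rw [hxA i hi],
      Finset.sum_congr (s₁ := B) (g := fun _ => (-a) ^ 2) rfl fun i hi => by rw [hxB i hi]]
    simp only [Finset.sum_const, nsmul_eq_mul]
    ring
  -- The total is `a * b * (a + b)`, at least `a * b ^ 2 ≥ m * b ^ 2` and at least `a ^ 2 * b ≥ m *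
  -- a ^ 2`. This prices the one extra separator neighbour of a vertex in `T`.
  have hxsq : ∀ i, x i ^ 2 ≤ (∑ i, x i ^ 2) / m := by
    intro i
    rw [hx2, le_div_iff₀ hm']
    by_cases hiA : i ∈ A
    · rw [hxA i hiA]
      nlinarith [mul_nonneg (mul_pos hb0 hb0).le (sub_nonneg.2 ham), mul_pos (mul_pos ha0 hb0) ha0]
    by_cases hiB : i ∈ B
    · rw [hxB i hiB]
      nlinarith [mul_nonneg (mul_pos ha0 ha0).le (sub_nonneg.2 hbm), mul_pos (mul_pos ha0 hb0) hb0]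
    · rw [hx0 i hiA hiB]
      have := mul_pos (mul_pos ha0 hb0) (add_pos ha0 hb0)
      simpa using this.le
  refine fiedlerValue_le_of_lapForm_le h hx1 (by rw [hx2]; positivity) ?_
  -- Edges inside `A` or inside `B` contribute nothing, and none join the two; an edge with an end
  -- in the separator contributes the square of the value at its other end.
  have hterm : ∀ i j, (if G.Adj i j then (x i - x j) ^ 2 else 0) ≤
      (if G.Adj i j ∧ j ∉ A ∧ j ∉ B then x i ^ 2 else 0) +
      (if G.Adj j i ∧ i ∉ A ∧ i ∉ B then x j ^ 2 else 0) := by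
    intro i j
    by_cases hadj : G.Adj i j
    · have hadj' := hadj.symm
      by_cases hj : j ∉ A ∧ j ∉ B
      · simp only [hadj, hj, hadj', hx0 j hj.1 hj.2]
        simp
      by_cases hi : i ∉ A ∧ i ∉ B
      · simp only [hadj, hi, hadj', hx0 i hi.1 hi.2]
        simp
      have hxx : x i = x j := by
        by_cases hiA : i ∈ A
        · by_cases hjA : j ∈ A
          · rw [hxA i hiA, hxA j hjA]
          · exact absurd hadj (hsep i hiA j (by tauto))
        · have hiB : i ∈ B := by tauto
          by_cases hjA : j ∈ A
          · exact absurd hadj' (hsep j hjA i hiB)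
          · rw [hxB i hiB, hxB j (by tauto)]
      rw [hxx]
      simp only [sub_self]
      split_ifs <;> nlinarith [sq_nonneg (x j)]
    · rw [if_neg hadj]
      split_ifs <;> positivity
  have hcount : ∀ i, ∑ j, (if G.Adj i j ∧ j ∉ A ∧ j ∉ B then x i ^ 2 else 0) ≤
      x i ^ 2 + if i ∈ T then (∑ i, x i ^ 2) / m else 0 := by
    intro i
    rw [← Finset.sum_filter, Finset.sum_const, nsmul_eq_mul]
    refine (mul_le_mul_of_nonneg_right (hdeg i) (sq_nonneg _)).trans ?_
    split_ifs
    · linarith [hxsq i]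
    · linarith
  have htot : ∑ i, ∑ j, (if G.Adj i j ∧ j ∉ A ∧ j ∉ B then x i ^ 2 else 0) ≤
      (1 + T.card / m) * ∑ i, x i ^ 2 := by
    refine (Finset.sum_le_sum fun i _ => hcount i).trans (le_of_eq ?_)
    rw [Finset.sum_add_distrib, ← Finset.sum_filter, Finset.sum_const, nsmul_eq_mul]
    simp only [Finset.filter_univ_mem]
    ring
  unfold lapForm
  rw [div_le_iff₀ two_pos]
  refine (Finset.sum_le_sum fun i _ => Finset.sum_le_sum fun j _ => hterm i j).trans ?_
  simp only [Finset.sum_add_distrib]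
  rw [Finset.sum_comm (f := fun i j => if G.Adj j i ∧ i ∉ A ∧ i ∉ B then x j ^ 2 else 0)]
  linarith

end FiedlerOuterplanar

/-! ### Cycles and chords in theta-free graphs -/

namespace FiedlerOuterplanar

variable {V : Type*} {G : SimpleGraph V}

theorem isChain_adj_reverse {a b : V} {p : List V} (h : (a :: p ++ [b]).IsChain G.Adj) :
    (b :: p.reverse ++ [a]).IsChain G.Adj := by
  have h' : (a :: p ++ [b]).reverse.IsChain G.Adj := by
    rw [List.isChain_reverse]
    exact h.imp fun _ _ hab => hab.symm
  simpa using h'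

/-- The list `x :: l` runs once around a cycle. A single edge counts as a cycle with two
vertices. -/
def IsCycleList (G : SimpleGraph V) (x : V) (l : List V) : Prop :=
  (x :: l).Nodup ∧ (x :: l ++ [x]).IsChain G.Adj

theorem isChain_cons_append_cons {x y z : V} {l₁ l₂ : List V} :
    (x :: (l₁ ++ y :: l₂) ++ [z]).IsChain G.Adj ↔
      (x :: l₁ ++ [y]).IsChain G.Adj ∧ (y :: l₂ ++ [z]).IsChain G.Adj := by
  have h : x :: (l₁ ++ y :: l₂) ++ [z] = (x :: l₁) ++ y :: (l₂ ++ [z]) := by simp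
  rw [h, List.isChain_split]
  simp

theorem IsCycleList.rotate {x y : V} {l₁ l₂ : List V} (h : IsCycleList G x (l₁ ++ y :: l₂)) :
    IsCycleList G y (l₂ ++ x :: l₁) := by
  refine ⟨?_, ?_⟩
  · refine (List.Perm.nodup_iff ?_).1 h.1
    have : x :: (l₁ ++ y :: l₂) = (x :: l₁) ++ (y :: l₂) := by simp
    rw [this]
    exact List.perm_append_comm
  · have := h.2
    rw [isChain_cons_append_cons] at this ⊢
    exact this.symm

theorem IsCycleList.exists_rotate {x c : V} {l : List V} (h : IsCycleList G x l)
    (hc : c ∈ x :: l) : ∃ l', IsCycleList G c l' ∧ (c :: l').Perm (x :: l) := by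
  rcases List.mem_cons.1 hc with rfl | hc
  · exact ⟨l, h, List.Perm.refl _⟩
  · obtain ⟨l₁, l₂, rfl⟩ := List.append_of_mem hc
    refine ⟨_, h.rotate, ?_⟩
    have : x :: (l₁ ++ c :: l₂) = (x :: l₁) ++ (c :: l₂) := by simp
    rw [this, ← List.cons_append]
    exact List.perm_append_comm

theorem IsCycleList.insert {x y : V} {l p : List V} (h : IsCycleList G x (y :: l))
    (hp : (x :: p ++ [y]).IsChain G.Adj) (hnd : p.Nodup) (hdis : ∀ z ∈ p, z ∉ x :: y :: l) :
    IsCycleList G x (p ++ y :: l) := by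
  refine ⟨?_, isChain_cons_append_cons.2 ⟨hp, ?_⟩⟩
  · have h₁ := h.1
    rw [List.nodup_cons] at h₁ ⊢
    refine ⟨fun hx => ?_, List.Nodup.append hnd h₁.2 fun z hz hz' =>
      hdis z hz (List.mem_cons_of_mem _ hz')⟩
    rcases List.mem_append.1 hx with hx | hx
    · exact hdis x hx (by simp)
    · exact h₁.1 hx
  · have h₂ := h.2
    rw [← List.nil_append (y :: l), isChain_cons_append_cons] at h₂
    exact h₂.2

/-- No set of vertices is separated from other vertices by a single vertex. -/
def NoCutVertex (G : SimpleGraph V) : Prop :=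
  ∀ (X : Set V) (v : V), X.Nonempty → v ∉ X → (∀ a ∈ X, ∀ b, G.Adj a b → b ∈ X ∨ b = v) →
    ∀ w, w ∈ X ∨ w = v

/-- A component of the graph off the cycle attaches to at least two vertices of the cycle, since one
attachment would be a cut vertex. A path through the component joins them. If they are consecutive
on the cycle the path is a detour that lengthens it; otherwise the path and both sides of the cycle
form a theta. -/
theorem IsCycleList.exists_longer (hG : ThetaFree G) (hcut : NoCutVertex G) {x w : V}
    {l : List V} (h : IsCycleList G x l) (hl : l ≠ []) (hw : w ∉ x :: l) :
    ∃ x' l', IsCycleList G x' l' ∧ l.length < l'.length := by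
  let H : SimpleGraph V :=
    { Adj := fun a b => G.Adj a b ∧ a ∉ x :: l ∧ b ∉ x :: l
      symm := ⟨fun a b h => ⟨h.1.symm, h.2.2, h.2.1⟩⟩
      loopless := ⟨fun a h => G.loopless.irrefl a h.1⟩ }
  have hsupp : ∀ {a b : V} (q : H.Walk a b), a ∉ x :: l → ∀ z ∈ q.support, z ∉ x :: l := by
    intro a b q
    induction q with
    | nil => intro ha z hz; simp only [SimpleGraph.Walk.support_nil, List.mem_singleton] at hz
             exact hz ▸ ha
    | cons hadj q ih =>
      intro ha z hz
      rw [SimpleGraph.Walk.support_cons, List.mem_cons] at hz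
      rcases hz with rfl | hz
      · exact ha
      · exact ih hadj.2.2 z hz
  let X : Set V := {z | H.Reachable w z}
  have hXl : ∀ z ∈ X, z ∉ x :: l := fun z ⟨q⟩ => hsupp q hw z q.end_mem_support
  have hwX : X.Nonempty := ⟨w, SimpleGraph.Reachable.refl w⟩
  have hXadj : ∀ a ∈ X, ∀ b, G.Adj a b → b ∉ X → b ∈ x :: l := by
    intro a ha b hab hb
    by_contra hbl
    exact hb (SimpleGraph.Reachable.trans ha (SimpleGraph.Adj.reachable ⟨hab, hXl a ha, hbl⟩))
  have hsecond : ∀ c ∈ x :: l, ∃ a ∈ X, ∃ b ∈ x :: l, G.Adj a b ∧ b ≠ c := by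
    intro c hc
    by_contra! hcon
    have hall := hcut X c hwX (fun hcX => hXl c hcX hc) fun a ha b hab => by
      by_contra! hb
      exact hb.2 (hcon a ha b (hXadj a ha b hab hb.1) hab)
    have hall' : ∀ z ∈ x :: l, z = c := fun z hz =>
      (hall z).resolve_left fun hzX => hXl z hzX hz
    obtain ⟨y, l', rfl⟩ := List.exists_cons_of_ne_nil hl
    have h₁ := hall' x (by simp)
    have h₂ := hall' y (by simp)
    have := h.1
    rw [h₁, h₂] at this
    simp at this
  obtain ⟨a₁, ha₁, c₁, hc₁, hac₁, -⟩ := hsecond x (by simp)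
  obtain ⟨a₂, ha₂, c₂, hc₂, hac₂, hne⟩ := hsecond c₁ hc₁
  obtain ⟨l', hl', hperm⟩ := h.exists_rotate hc₁
  have hlen : l'.length = l.length := by simpa using hperm.length_eq
  have hmem : ∀ z, z ∈ c₁ :: l' ↔ z ∈ x :: l := fun z => hperm.mem_iff
  have hc₂' : c₂ ∈ l' := by
    have := (hmem c₂).2 hc₂
    exact (List.mem_cons.1 this).resolve_left hne
  classical
  obtain ⟨q⟩ : H.Reachable a₁ a₂ := (SimpleGraph.Reachable.symm ha₁).trans ha₂
  let p : List V := q.toPath.1.support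
  have hpnd : p.Nodup := q.toPath.2.support_nodup
  have hpne : p ≠ [] := SimpleGraph.Walk.support_ne_nil _
  have hpl : ∀ z ∈ p, z ∉ c₁ :: l' := fun z hz hz' =>
    hsupp q.toPath.1 (hXl a₁ ha₁) z hz ((hmem z).1 hz')
  have hpch : (c₁ :: p ++ [c₂]).IsChain G.Adj := by
    have h₁ : p.IsChain G.Adj := (SimpleGraph.Walk.isChain_adj_support _).imp fun _ _ h => h.1
    rw [List.cons_append]
    refine List.IsChain.cons (List.IsChain.append h₁ (by simp) ?_) ?_
    · intro y hy z hz
      have hy' : p.getLast? = some a₂ := by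
        rw [List.getLast?_eq_some_getLast hpne]
        simp [p]
      rw [hy'] at hy
      simp only [Option.mem_def, Option.some.injEq, List.head?_cons] at hy hz
      subst hy hz
      exact hac₂
    · intro y hy
      have hy' : (p ++ [c₂]).head? = some a₁ := by
        rw [List.head?_append_of_ne_nil _ hpne, List.head?_eq_some_head hpne]
        simp [p]
      rw [hy'] at hy
      simp only [Option.mem_def, Option.some.injEq] at hy
      subst hy
      exact hac₁.symm
  have hplen : 0 < p.length := List.length_pos_iff.2 hpne
  obtain ⟨l₁, l₂, rfl⟩ := List.append_of_mem hc₂'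
  rcases eq_or_ne l₁ [] with rfl | hl₁
  · refine ⟨c₁, p ++ c₂ :: l₂, IsCycleList.insert hl' hpch hpnd hpl, ?_⟩
    simp only [List.nil_append, List.length_cons, List.length_append] at hlen ⊢
    omega
  rcases eq_or_ne l₂ [] with rfl | hl₂
  · refine ⟨c₂, p.reverse ++ c₁ :: l₁, IsCycleList.insert hl'.rotate (isChain_adj_reverse hpch)
      (List.nodup_reverse.2 hpnd) ?_, ?_⟩
    · intro z hz hz'
      refine hpl z (List.mem_reverse.1 hz) ?_
      simp only [List.mem_cons, List.mem_append] at hz' ⊢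
      tauto
    · simp only [List.length_cons, List.length_append, List.length_nil, List.length_reverse]
        at hlen ⊢
      omega
  · exfalso
    have hnd := hl'.1
    rw [List.nodup_cons, List.nodup_append] at hnd
    obtain ⟨hn₁, hn₂, hn₃, hn₄⟩ := hnd
    rw [List.nodup_cons] at hn₃
    simp only [List.mem_append, List.mem_cons, not_or] at hn₁ hpl
    obtain ⟨hch₁, hch₂⟩ := isChain_cons_append_cons.1 hl'.2
    refine hG c₁ c₂ p l₁ l₂.reverse hne.symm hpne hl₁ (by simpa using hl₂)
      (fun h => (hpl _ h).1 rfl) hn₁.1 (by simpa using hn₁.2.2)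
      (fun h => (hpl _ h).2.2.1 rfl) (fun h => hn₄ c₂ h c₂ (by simp) rfl) (by simpa using hn₃.1)
      (fun z hz hz' => (hpl z hz).2.1 hz') (fun z hz hz' => (hpl z hz).2.2.2 (by simpa using hz'))
      (fun z hz hz' => hn₄ z hz z (by simp at hz'; simp [hz']) rfl) hpch hch₁
      (isChain_adj_reverse hch₂)

/-- A theta-free graph without cut vertices has a Hamiltonian cycle. -/
theorem exists_hamiltonian_isCycleList [Fintype V] (hG : ThetaFree G) (hcut : NoCutVertex G)
    (hcard : 3 ≤ Fintype.card V) :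
    ∃ x l, IsCycleList G x l ∧ l.length + 1 = Fintype.card V := by
  by_contra! hcon
  have hlong : ∀ k : ℕ, ∃ x l, IsCycleList G x l ∧ l ≠ [] ∧ k ≤ l.length := by
    intro k
    induction k with
    | zero =>
      -- The growth starts from a single edge at `u`. If `u` were isolated, `{u}` would be cut off
      -- from the third vertex `w` by `v`.
      obtain ⟨u, v, w, huv, huw, hvw⟩ := Fintype.two_lt_card_iff.1 hcard
      obtain ⟨y, hy⟩ : ∃ y, G.Adj u y := by
        by_contra! h
        rcases hcut {u} v (Set.singleton_nonempty u) (by simpa using huv.symm)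
          (fun a ha b hab => absurd (Set.mem_singleton_iff.1 ha ▸ hab) (h b)) w with h | h
        · exact huw h.symm
        · exact hvw h.symm
      refine ⟨u, [y], ⟨by simpa using hy.ne, by simpa using ⟨hy, hy.symm⟩⟩, by simp, by simp⟩
    | succ k ih =>
      obtain ⟨x, l, h, hl, hk⟩ := ih
      obtain ⟨w, hw⟩ : ∃ w, w ∉ x :: l := by
        by_contra! hall
        refine hcon x l h ?_
        classical
        have h₁ := List.toFinset_card_of_nodup h.1
        have h₂ : (x :: l).toFinset = Finset.univ := by
          ext z; simpa using hall z
        rw [h₂, Finset.card_univ] at h₁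
        simpa using h₁.symm
      obtain ⟨x', l', h', hlt⟩ := h.exists_longer hG hcut hl hw
      exact ⟨x', l', h', by rintro rfl; simp at hlt, by omega⟩
  obtain ⟨x, l, h, -, hk⟩ := hlong (Fintype.card V)
  have := h.1.length_le_card
  simp only [List.length_cons] at this
  omega

/-- The theta joins `a` to `k`: along `p`, by the chord to `j` and back through `q`, and back
through `s` to `c` followed by the chord to `k`. Only the first arm can lack an internal vertex,
whence `p ≠ []`. -/
theorem IsCycleList.false_of_crossing_of_ne_nil (hG : ThetaFree G) {a k j c : V}
    {p q r s : List V} (h : IsCycleList G a (p ++ k :: (q ++ j :: (r ++ c :: s)))) (hp : p ≠ [])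
    (haj : G.Adj a j) (hkc : G.Adj k c) : False := by
  obtain ⟨hch₁, hch₂⟩ := isChain_cons_append_cons.1 h.2
  obtain ⟨hch₃, hch₄⟩ := isChain_cons_append_cons.1 hch₂
  obtain ⟨-, hch₅⟩ := isChain_cons_append_cons.1 hch₄
  have hnd := h.1
  simp only [List.nodup_cons, List.nodup_append, List.mem_append, List.mem_cons, not_or] at hnd
  obtain ⟨⟨n₁, n₂, n₃, n₄, n₅, n₆, n₇⟩, m₁, ⟨⟨k₁, k₂, k₃, k₄, k₅⟩, hq, ⟨⟨j₁, j₂, j₃⟩, hr, ⟨c₁, hs⟩,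
    hrs⟩, hqr⟩, hpq⟩ := hnd
  have hrev₁ : (a :: (j :: q.reverse) ++ [k]).IsChain G.Adj :=
    List.isChain_cons_cons.2 ⟨haj, isChain_adj_reverse hch₃⟩
  have hrev₂ : (a :: (c :: s).reverse ++ [k]).IsChain G.Adj :=
    isChain_adj_reverse (List.isChain_cons_cons.2 ⟨hkc, hch₅⟩)
  refine hG a k p (j :: q.reverse) (c :: s).reverse n₂ hp (by simp) (by simp) n₁ ?_ ?_ ?_ ?_ ?_
    ?_ ?_ ?_ hch₁ hrev₁ hrev₂
  · simp [n₃, n₄]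
  · simp [n₆, n₇]
  · exact fun hk => hpq k hk k (by simp) rfl
  · simp [k₁, k₂]
  · simp [k₄, k₅]
  · intro z hz hz'
    simp only [List.mem_cons, List.mem_reverse] at hz'
    exact hpq z hz z (by tauto) rfl
  · intro z hz hz'
    simp only [List.mem_cons, List.mem_reverse] at hz'
    exact hpq z hz z (by tauto) rfl
  · intro z hz hz'
    simp only [List.mem_cons, List.mem_reverse] at hz hz'
    rcases hz with rfl | hz
    · rcases hz' with rfl | hz'
      · exact j₂ rfl
      · exact j₃ hz'
    · exact hqr z hz z (by tauto) rfl

/-- In a theta-free graph the chords of a cycle with at least five vertices do not cross. -/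
theorem IsCycleList.false_of_crossing (hG : ThetaFree G) {a k j c : V} {p q r s : List V}
    (h : IsCycleList G a (p ++ k :: (q ++ j :: (r ++ c :: s))))
    (hlen : 4 ≤ (p ++ k :: (q ++ j :: (r ++ c :: s))).length)
    (haj : G.Adj a j) (hkc : G.Adj k c) : False := by
  have h₁ : IsCycleList G k (q ++ j :: (r ++ c :: (s ++ a :: p))) := by
    simpa using h.rotate
  have h₂ : IsCycleList G j (r ++ c :: (s ++ a :: (p ++ k :: q))) := by
    simpa using h₁.rotate
  have h₃ : IsCycleList G c (s ++ a :: (p ++ k :: (q ++ j :: r))) := by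
    simpa using h₂.rotate
  -- Rotation makes any nonempty gap between chord ends play the role of `p`. If all four gaps are
  -- empty the cycle has four vertices, where crossing chords are possible (`K₄` is theta-free); the
  -- length hypothesis excludes this.
  rcases eq_or_ne p [] with rfl | hp
  swap
  · exact h.false_of_crossing_of_ne_nil hG hp haj hkc
  rcases eq_or_ne q [] with rfl | hq
  swap
  · exact h₁.false_of_crossing_of_ne_nil hG hq hkc haj.symm
  rcases eq_or_ne r [] with rfl | hr
  swap
  · exact h₂.false_of_crossing_of_ne_nil hG hr haj.symm hkc.symm
  rcases eq_or_ne s [] with rfl | hs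
  swap
  · exact h₃.false_of_crossing_of_ne_nil hG hs hkc.symm haj
  simp at hlen

theorem exists_last_split {α : Type*} {P : α → Prop} {l : List α} (h : ∃ z ∈ l, P z) :
    ∃ l₁ k l₂, l = l₁ ++ k :: l₂ ∧ P k ∧ ∀ z ∈ l₂, ¬ P z := by
  induction l with
  | nil => simp at h
  | cons y l ih =>
    by_cases hl : ∃ z ∈ l, P z
    · obtain ⟨l₁, k, l₂, rfl, hk, hall⟩ := ih hl
      exact ⟨y :: l₁, k, l₂, rfl, hk, hall⟩
    · push Not at hl
      obtain ⟨z, hz, hPz⟩ := h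
      rcases List.mem_cons.1 hz with rfl | hz
      · exact ⟨[], z, l, rfl, hPz, hl⟩
      · exact absurd hPz (hl z hz)

/-- A cycle of a theta-free graph is split by two of its vertices into two parts of comparable
size that are not joined by a chord. -/
theorem exists_balanced_split (hG : ThetaFree G) {t n : ℕ} (hn : 5 ≤ n) {u v : V}
    {A B : List V} (hcyc : IsCycleList G u (A ++ v :: B)) (hlen : A.length + B.length + 2 = n)
    (hsep : ∀ a ∈ A, ∀ b ∈ B, ¬ G.Adj a b) (hA : t ≤ A.length) :
    ∃ (u v : V) (A B : List V), IsCycleList G u (A ++ v :: B) ∧ A.length + B.length + 2 = n ∧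
      (∀ a ∈ A, ∀ b ∈ B, ¬ G.Adj a b) ∧ t ≤ A.length ∧ A.length ≤ 2 * t := by
  induction hk : A.length using Nat.strong_induction_on generalizing u v A B with
  | _ m ih =>
    subst hk
    by_cases hle : A.length ≤ 2 * t
    · exact ⟨u, v, A, B, hcyc, hlen, hsep, hA, hle⟩
    have hex : ∃ z ∈ A, G.Adj u z := by
      have hne : A ≠ [] := by rintro rfl; simp at hle
      obtain ⟨z, A', rfl⟩ := List.exists_cons_of_ne_nil hne
      have := hcyc.2
      simp only [List.cons_append, List.isChain_cons_cons] at this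
      exact ⟨z, by simp, this.1⟩
    obtain ⟨A₁, k, A₂, rfl, huk, hmax⟩ := exists_last_split hex
    have hcyc₁ : IsCycleList G u (A₁ ++ k :: (A₂ ++ v :: B)) := by simpa using hcyc
    -- Such an edge would cross the edge `u k`.
    have hcross : ∀ w ∈ A₁, ∀ z ∈ A₂ ++ v :: B, ¬ G.Adj w z := by
      intro w hw z hz hwz
      obtain ⟨a₁, a₂, rfl⟩ := List.append_of_mem hw
      obtain ⟨b₁, b₂, hb⟩ := List.append_of_mem hz
      have hb' := congrArg List.length hb
      rw [hb] at hcyc₁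
      simp only [List.append_assoc, List.cons_append] at hcyc₁
      refine hcyc₁.false_of_crossing hG ?_ huk hwz
      simp only [List.length_append, List.length_cons] at hlen hb' ⊢
      omega
    simp only [List.length_append, List.length_cons] at hlen hle hA ih
    -- The pair `u`, `k` cuts off `A₁`, and the pair `k`, `v` cuts off `A₂`, the choice of `k` as
    -- the last neighbour of `u` in `A` keeping `u` away from `A₂`. Since `|A| > 2 * t`, if `A₁` has
    -- fewer than `t` vertices then `A₂` has more than `t`.
    by_cases h₁ : t ≤ A₁.length
    · refine ih A₁.length (by omega) hcyc₁ ?_ hcross h₁ rfl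
      simp only [List.length_append, List.length_cons]
      omega
    · have hcyc₂ : IsCycleList G k (A₂ ++ v :: (B ++ u :: A₁)) := by
        simpa using hcyc₁.rotate
      refine ih A₂.length (by omega) hcyc₂ ?_ ?_ (by omega) rfl
      · simp only [List.length_append, List.length_cons]
        omega
      · intro w hw z hz hwz
        rcases List.mem_append.1 hz with hz | hz
        · exact hsep w (by simp [hw]) z hz hwz
        rcases List.mem_cons.1 hz with rfl | hz
        · exact hmax w hw hwz.symm
        · exact hcross z hz w (by simp [hw]) hwz.symm

/-- In a theta-free graph two vertices have at most two common neighbours. -/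
theorem ThetaFree.card_le_two (hG : ThetaFree G) {u v : V} (huv : u ≠ v) {T : Finset V}
    (hT : ∀ w ∈ T, G.Adj u w ∧ G.Adj w v) : T.card ≤ 2 := by
  by_contra! hcon
  obtain ⟨a, b, c, ha, hb, hc, hab, hac, hbc⟩ := Finset.two_lt_card_iff.1 hcon
  have h : ∀ w ∈ T, u ∉ [w] ∧ v ∉ [w] ∧ (u :: [w] ++ [v]).IsChain G.Adj := fun w hw => by
    obtain ⟨h₁, h₂⟩ := hT w hw
    simp [h₁.ne, h₂.ne', h₁, h₂]
  exact hG u v [a] [b] [c] huv (by simp) (by simp) (by simp) (h a ha).1 (h b hb).1 (h c hc).1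
    (h a ha).2.1 (h b hb).2.1 (h c hc).2.1 (by simpa using hab.symm) (by simpa using hac.symm)
    (by simpa using hbc.symm) (h a ha).2.2 (h b hb).2.2 (h c hc).2.2

/-! ### The bound for theta-free graphs -/

variable [Fintype V]

theorem noCutVertex_of_one_lt_fiedlerValue (h : 2 ≤ Fintype.card V)
    (hlt : 1 < fiedlerValue G h) : NoCutVertex G := by
  classical
  intro X v hX hv hadj w
  by_contra! hw
  refine absurd hlt (not_lt.2 ?_)
  -- The separator `{v}` gives every vertex at most one neighbour in it, so the exceptional set is
  -- empty and the bound is exactly 1.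
  have := fiedlerValue_le_of_separation h (G := G) (Finset.univ.filter (· ∈ X))
    (Finset.univ.filter fun z => z ∉ X ∧ z ≠ v) ∅ one_pos
    (Finset.card_pos.2 (hX.imp fun z hz => by simpa using hz))
    (Finset.card_pos.2 ⟨w, by simpa using hw⟩)
    (Finset.disjoint_left.2 fun z hz hz' => by simp at hz hz'; exact hz'.1 hz)
    (fun a ha b hb hab => by
      simp only [Finset.mem_filter, Finset.mem_univ, true_and] at ha hb
      rcases hadj a ha b hab with h | h
      · exact hb.1 h
      · exact hb.2 h)
    (fun z => by
      have hsub : (Finset.univ.filter fun s => G.Adj z s ∧ s ∉ Finset.univ.filter (· ∈ X) ∧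
          s ∉ Finset.univ.filter fun z => z ∉ X ∧ z ≠ v) ⊆ {v} := by
        intro s hs
        simp only [Finset.mem_filter, Finset.mem_univ, true_and, not_and, not_not] at hs
        exact Finset.mem_singleton.2 (hs.2.2 hs.2.1)
      have := Finset.card_le_card hsub
      rw [Finset.card_singleton] at this
      simpa using this)
  simpa using this

theorem ThetaFree.fiedlerValue_le (hG : ThetaFree G) (h : 2 ≤ Fintype.card V) :
    fiedlerValue G h ≤ 1 + 128 / (Fintype.card V : ℝ) := by
  classical
  have hpos : (0 : ℝ) < Fintype.card V := by exact_mod_cast (by omega : 0 < Fintype.card V)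
  by_cases h1 : fiedlerValue G h ≤ 1
  · exact h1.trans (le_add_of_nonneg_right (by positivity))
  -- The constant 128 comes from here: `2 * n ≤ 128 / n` for `n ≤ 8`. The main case needs only 16.
  by_cases h8 : Fintype.card V ≤ 8
  · refine (fiedlerValue_le_two_mul_card h).trans ?_
    have h8' : (Fintype.card V : ℝ) ≤ 8 := by exact_mod_cast h8
    have : (2 : ℝ) * Fintype.card V ≤ 128 / (Fintype.card V : ℝ) := by
      rw [le_div_iff₀ hpos]
      nlinarith
    linarith
  have hcut := noCutVertex_of_one_lt_fiedlerValue h (not_le.1 h1)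
  obtain ⟨x, l, hcyc, hlen⟩ := exists_hamiltonian_isCycleList hG hcut (by omega)
  have hl : l ≠ [] := by rintro rfl; simp at hlen; omega
  obtain ⟨l, y, rfl⟩ := List.eq_nil_or_concat l |>.resolve_left hl
  rw [List.concat_eq_append] at hcyc hlen
  simp only [List.length_append, List.length_cons, List.length_nil] at hlen
  set n := Fintype.card V with hn
  -- The initial split has two neighbours on the cycle as separator and `B` empty. In the final one,
  -- `|A| ≤ 2 * (n / 4)` leaves `B` at least `n / 4` vertices because `n ≥ 9`.
  obtain ⟨u, v, A, B, hcyc, hAB, hsep, hA₁, hA₂⟩ := exists_balanced_split hG (t := n / 4) (n := n)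
    (by omega) hcyc (by simp; omega) (by simp) (by omega)
  have hnd := hcyc.1
  have hall : ∀ z, z ∈ u :: (A ++ v :: B) := by
    have h₁ := List.toFinset_card_of_nodup hnd
    have h₂ : (u :: (A ++ v :: B)).toFinset = Finset.univ := by
      rw [← Finset.card_eq_iff_eq_univ, h₁]
      simp only [List.length_append, List.length_cons]
      omega
    intro z
    rw [← List.mem_toFinset, h₂]
    exact Finset.mem_univ z
  simp only [List.nodup_cons, List.nodup_append, List.mem_append, List.mem_cons, not_or] at hnd hall
  obtain ⟨⟨-, huv, -⟩, hAnd, ⟨-, hBnd⟩, hdis⟩ := hnd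
  set T : Finset V := Finset.univ.filter fun w => G.Adj u w ∧ G.Adj w v with hT
  have hT2 : T.card ≤ 2 := hG.card_le_two huv fun w hw => by simpa [hT] using hw
  have hle := fiedlerValue_le_of_separation h (G := G) A.toFinset B.toFinset T (m := n / 4)
    (by omega) (by rwa [List.toFinset_card_of_nodup hAnd])
    (by rw [List.toFinset_card_of_nodup hBnd]; omega)
    (Finset.disjoint_left.2 fun z hz hz' => hdis z (by simpa using hz) z
      (Or.inr (by simpa using hz')) rfl)
    (fun a ha b hb => hsep a (by simpa using ha) b (by simpa using hb))
    (fun w => by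
      have hsub : (Finset.univ.filter fun s => G.Adj w s ∧ s ∉ A.toFinset ∧ s ∉ B.toFinset) ⊆
          ({u, v} : Finset V).filter (G.Adj w) := by
        intro s hs
        simp only [Finset.mem_filter, Finset.mem_univ, true_and, List.mem_toFinset] at hs
        have := hall s
        simp only [Finset.mem_filter, Finset.mem_insert, Finset.mem_singleton]
        tauto
      have hcard := Finset.card_le_card hsub
      have hcard' : (({u, v} : Finset V).filter (G.Adj w)).card ≤ 1 + if w ∈ T then 1 else 0 := by
        rw [Finset.filter_insert, Finset.filter_singleton]
        simp only [hT, Finset.mem_filter, Finset.mem_univ, true_and, G.adj_comm u w]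
        by_cases hu : G.Adj w u <;> by_cases hv : G.Adj w v <;> simp [hu, hv, huv]
      have := hcard.trans hcard'
      exact_mod_cast this)
  refine hle.trans ?_
  have hm : (0 : ℝ) < (n / 4 : ℕ) := by exact_mod_cast (by omega : 0 < n / 4)
  -- With `m = n / 4` rounded down, `m ≥ n / 8`, so the error `|T| / m` is at most `16 / n`.
  have hmn : (n : ℝ) ≤ 8 * (n / 4 : ℕ) := by exact_mod_cast (by omega : n ≤ 8 * (n / 4))
  have hT2' : (T.card : ℝ) ≤ 2 := by exact_mod_cast hT2
  gcongr 1 + ?_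
  rw [div_le_div_iff₀ hm hpos]
  nlinarith

end FiedlerOuterplanar

theorem theorem7 :
    ∃ C : ℝ, ∀ (V : Type*) [Fintype V] (h : 2 ≤ Fintype.card V) (G : SimpleGraph V),
      FiedlerOuterplanar.IsOuterplanar G →
        FiedlerOuterplanar.fiedlerValue G h ≤ 1 + C / (Fintype.card V : ℝ) :=
  ⟨128, fun _ _ h _ hG => hG.thetaFree.fiedlerValue_le h⟩
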